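/- Let $n,m\ge 0$, let $Q\in\mathbb{R}^{n\times n}$ be symmetric positive semidefinite, $c,a_1,\dots,a_m\in\mathbb{R}^n$, $\mathcal{B}\subseteq[n]$, and let $b_1,\dots,b_m:\mathbb{R}\to\mathbb{R}$ be functions of a scalar parameter $\theta$. Consider the mixed-binary quadratic program $$\mathcal{P}^{\mathrm{MBQP}}(\theta):\quad \min\ x^\top Qx+c^\top x\quad\text{s.t. } a_j^\top x=b_j(\theta)\ (j\in[m]),\ x\in\mathbb{R}^n_+,\ x_i\in\{0,1\}\ (i\in\mathcal{B}).$$ Fix $\theta$. Suppose that $\mathcal{P}^{\mathrm{MBQP}}(\theta)$ is feasible and that real numbers $U_i$, $i\in[n]\setminus\mathcal{B}$, are such that every feasible $x$ satisfies $x_i\le U_i$ for all $i\in[n]\setminus\mathcal{B}$. Consider the strengthened doubly nonnegative relaxation $$\mathcal{P}^{\mathrm{SDP\text{-}bd}}(\theta):\quad \min_{x\in\mathbb{R}^n,\,X\in\mathbb{R}^{n\times n}}\ \operatorname{Tr}(Q^\top X)+c^\top x$$ subject to $a_j^\top x=b_j(\theta)$ and $\operatorname{Tr}(a_ja_j^\top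 X)=b_j(\theta)^2$ for $j\in[m]$, $X_{ii}\le U_i^2$ for $i\in[n]\setminus\mathcal{B}$, $x_i=X_{ii}$ for $i\in\mathcal{B}$, and $Y:=\begin{bmatrix}1&x^\top\\x&X\end{bmatrix}$ positive semidefinite (in particular symmetric) and entrywise nonnegative; and its dual, over $\gamma,\omega\in\mathbb{R}^m$, $\kappa\in\mathbb{R}^{\mathcal{B}}$, $\phi\in\mathbb{R}^{[n]\setminus\mathcal{B}}$, $\mu\in\mathbb{R}$ and $\Theta,\Omega\in\mathbb{R}^{(n+1)\times(n+1)}$, $$\mathcal{P}^{\mathrm{SDP\text{-}dual}}(\theta):\quad \sup\ \sum_{j=1}^m b_j(\theta)\gamma_j+\sum_{j=1}^m b_j(\theta)^2\omega_j+\mu+\sum_{i\in[n]\setminus\mathcal{B}}U_i^2\phi_i$$ subject to $\phi\le 0$, $\Theta\ge 0$ entrywise, $\Omega$ positive semidefinite, and $$\begin{bmatrix}0&\tfrac12c^\top\\\tfrac12c&Q\end{bmatrix}-\sum_{j=1}^m\gamma_j\begin{bmatrix}0&\tfrac12a_j^\top\\\tfrac12a_j&0\end{bmatrix}-\sum_{j=1}^m\omega_j\begin{bmatrix}0&0\\0&a_ja_j^\top\end{bmatrix}-\sum_{i\in\mathcal{B}}\kappa_i\begin{bmatrix}0&\tfrac12e_i^\top\\\tfrac12e_i&-e_ie_i^\top\end{bmatrix}-\sum_{i\in[n]\setminus\mathcal{B}}\phi_i\begin{bmatrix}0&0\\0&e_ie_i^\top\end{bmatrix}-\mu\begin{bmatrix}1&0\\0&0\end{bmatrix}=\Theta+\Omega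 .$$ Then strong duality holds between $\mathcal{P}^{\mathrm{SDP\text{-}bd}}(\theta)$ and $\mathcal{P}^{\mathrm{SDP\text{-}dual}}(\theta)$: both are feasible, their optimal values are finite and equal, and the optimal value of $\mathcal{P}^{\mathrm{SDP\text{-}bd}}(\theta)$ is attained. -/

import Mathlib

open scoped Matrix

/-- Data of a parametrized mixed-binary quadratic program
`min xᵀ Q x + cᵀ x` subject to `a jᵀ x = b j θ` for all `j`, `x ≥ 0`, and `x i ∈ {0, 1}` for
`i ∈ B`. The scalar parameter `θ` enters through the right-hand sides only. -/
structure ParamMBQP (n m : ℕ) where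
  Q : Matrix (Fin n) (Fin n) ℝ
  c : Fin n → ℝ
  a : Fin m → Fin n → ℝ
  b : Fin m → ℝ → ℝ
  B : Finset (Fin n)

namespace ParamMBQP

variable {n m : ℕ}

/-- `x` is a feasible point of the program with parameter `θ`. -/
def IsFeasible (P : ParamMBQP n m) (θ : ℝ) (x : Fin n → ℝ) : Prop :=
  (∀ j, P.a j ⬝ᵥ x = P.b j θ) ∧ (∀ i, 0 ≤ x i) ∧ (∀ i ∈ P.B, x i = 0 ∨ x i = 1)

/-- On the feasible set of the program with parameter `θ`, every continuous variable `x i`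
is bounded above by `U i`. -/
def ContinuousVarsBoundedBy (P : ParamMBQP n m) (θ : ℝ) (U : Fin n → ℝ) : Prop :=
  ∀ x, P.IsFeasible θ x → ∀ i ∉ P.B, x i ≤ U i

/-- The symmetric block matrix with corner entry `t`, border vector `v` and lower right
block `S`. -/
def bordered (t : ℝ) (v : Fin n → ℝ) (S : Matrix (Fin n) (Fin n) ℝ) :
    Matrix (Unit ⊕ Fin n) (Unit ⊕ Fin n) ℝ :=
  Matrix.fromBlocks (Matrix.of fun _ _ => t) (Matrix.replicateRow Unit v)
    (Matrix.replicateCol Unit v) S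

/-- Feasibility of `(x, X)` for the strengthened doubly nonnegative relaxation; the matrix
`bordered 1 x X` is `Y`. -/
structure SDPFeasible (P : ParamMBQP n m) (U : Fin n → ℝ) (θ : ℝ)
    (x : Fin n → ℝ) (X : Matrix (Fin n) (Fin n) ℝ) : Prop where
  linear : ∀ j, P.a j ⬝ᵥ x = P.b j θ
  squared : ∀ j, (Matrix.vecMulVec (P.a j) (P.a j) * X).trace = P.b j θ ^ 2
  diag_le : ∀ i ∉ P.B, X i i ≤ U i ^ 2
  binary : ∀ i ∈ P.B, x i = X i i
  psd : (bordered 1 x X).PosSemidef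
  nonneg : ∀ k l, 0 ≤ bordered 1 x X k l

/-- Objective of the relaxation. -/
def sdpObjective (P : ParamMBQP n m) (x : Fin n → ℝ) (X : Matrix (Fin n) (Fin n) ℝ) : ℝ :=
  (P.Qᵀ * X).trace + P.c ⬝ᵥ x

/-- Objective values attained on the feasible set of the relaxation. -/
def sdpValues (P : ParamMBQP n m) (U : Fin n → ℝ) (θ : ℝ) : Set ℝ :=
  {v | ∃ x X, P.SDPFeasible U θ x X ∧ v = P.sdpObjective x X}

/-- Dual variables. Only the components `κ i` with `i ∈ B` and `φ i` with `i ∉ B` are ever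
used, and `μ` is the multiplier of the constraint that the corner entry of `Y` is `1`. -/
structure DualVars (n m : ℕ) where
  γ : Fin m → ℝ
  ω : Fin m → ℝ
  κ : Fin n → ℝ
  φ : Fin n → ℝ
  μ : ℝ
  Θ : Matrix (Unit ⊕ Fin n) (Unit ⊕ Fin n) ℝ
  Ω : Matrix (Unit ⊕ Fin n) (Unit ⊕ Fin n) ℝ

/-- The matrix `M(γ, ω, κ, φ, μ)`, that is, the cost matrix minus the constraint matrices
weighted by their multipliers. -/
noncomputable def dualMatrix (P : ParamMBQP n m) (D : DualVars n m) :
    Matrix (Unit ⊕ Fin n) (Unit ⊕ Fin n) ℝ :=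
  bordered 0 ((1 / 2 : ℝ) • P.c) P.Q
    - ∑ j, D.γ j • bordered 0 ((1 / 2 : ℝ) • P.a j) 0
    - ∑ j, D.ω j • bordered 0 0 (Matrix.vecMulVec (P.a j) (P.a j))
    - ∑ i ∈ P.B, D.κ i • bordered 0 ((1 / 2 : ℝ) • Pi.single i 1) (-Matrix.single i i 1)
    - ∑ i ∈ P.Bᶜ, D.φ i • bordered 0 0 (Matrix.single i i 1)
    - D.μ • bordered 1 0 0

/-- Feasibility for the dual; it does not involve the right-hand sides. -/
structure DualFeasible (P : ParamMBQP n m) (D : DualVars n m) : Prop where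
  stationarity : P.dualMatrix D = D.Θ + D.Ω
  phi_nonpos : ∀ i ∉ P.B, D.φ i ≤ 0
  theta_nonneg : ∀ k l, 0 ≤ D.Θ k l
  omega_psd : D.Ω.PosSemidef

/-- Objective of the dual. -/
def dualObjective (P : ParamMBQP n m) (U : Fin n → ℝ) (θ : ℝ) (D : DualVars n m) : ℝ :=
  ∑ j, P.b j θ * D.γ j + ∑ j, P.b j θ ^ 2 * D.ω j + D.μ + ∑ i ∈ P.Bᶜ, U i ^ 2 * D.φ i

/-- Objective values attained on the feasible set of the dual. -/
def dualValues (P : ParamMBQP n m) (U : Fin n → ℝ) (θ : ℝ) : Set ℝ :=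
  {v | ∃ D, P.DualFeasible D ∧ v = P.dualObjective U θ D}

/-- Strong duality: the relaxation attains its minimum, and this minimum is the supremum of
the dual objective over the dual feasible set. In particular both problems are feasible, both
optimal values are finite, and there is no duality gap. -/
def StrongDuality (P : ParamMBQP n m) (U : Fin n → ℝ) (θ : ℝ) : Prop :=
  ∃ v : ℝ, IsLeast (P.sdpValues U θ) v ∧ IsLUB (P.dualValues U θ) v

end ParamMBQP

/-!
The relaxation is a linear program over the cone of doubly nonnegative matrices, and its feasible
set is compact: the constraints bound the diagonal of `X`, and positive semidefiniteness bounds the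
other entries. It is nonempty because a feasible point `x` of the program lifts to `(x, x xᵀ)`, so
the minimum `v` is attained. Weak duality follows from the Lagrangian identity
`trace_bordered_mul_constraintMatrix`.

For the reverse inequality, consider the convex cone `dualCone` of all pairs `(M, r)` for which a
program with cost matrix `M` would have a dual feasible point of value `r`. If `C` is the cost
matrix and `w < v`, then `(C, w)` lies in this cone (`mem_dualValues_of_lt`). Otherwise, since the
cone spans the whole space, a nonzero functional separates `(C, w)` from it weakly; closedness of
the cone is not needed. Nonnegativity on the cone forces the symmetrized coefficients of the
functional to form a matrix `bordered t x X` satisfying the constraints of the relaxation with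
right-hand sides scaled by `t` (`exists_homogeneousFeasible_of_nonneg_on_dualCone`). If `t > 0`,
then rescaling gives a feasible point of value at most `w`, which is impossible. If `t = 0`, then the
same bounds that make the feasible set compact force the matrix to vanish
(`HomogeneousFeasible.bordered_eq_zero`), and entrywise nonnegativity makes the functional itself
vanish, which is impossible too.
-/

/-! ### Real matrices and their trace pairing -/

namespace Matrix

theorem trace_transpose_mul_eq_sum {ι : Type*} [Fintype ι] (A B : Matrix ι ι ℝ) :
    (Aᵀ * B).trace = ∑ i, ∑ j, A i j * B i j := by
  rw [Finset.sum_comm]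
  simp [trace, mul_apply]

theorem IsHermitian.isSymm {ι : Type*} {A : Matrix ι ι ℝ} (hA : A.IsHermitian) : A.IsSymm := by
  have := hA.eq
  rwa [conjTranspose_eq_transpose_of_trivial] at this

/-- The trace pairing of two positive semidefinite matrices is nonnegative: it is the quadratic
form of their Hadamard product at the all-ones vector. -/
theorem PosSemidef.trace_transpose_mul_nonneg {ι : Type*} [Fintype ι] {A B : Matrix ι ι ℝ}
    (hA : A.PosSemidef) (hB : B.PosSemidef) : 0 ≤ (Aᵀ * B).trace := by
  have h := (hA.hadamard hB).dotProduct_mulVec_nonneg (fun _ => 1)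
  rw [trace_transpose_mul_eq_sum]
  simpa [dotProduct, mulVec] using h

theorem trace_transpose_mul_nonneg_of_entrywise {ι : Type*} [Fintype ι] {A B : Matrix ι ι ℝ}
    (hA : ∀ i j, 0 ≤ A i j) (hB : ∀ i j, 0 ≤ B i j) : 0 ≤ (Aᵀ * B).trace := by
  rw [trace_transpose_mul_eq_sum]
  exact Finset.sum_nonneg fun i _ => Finset.sum_nonneg fun j _ => mul_nonneg (hA _ _) (hB _ _)

theorem PosSemidef.sq_apply_le {ι : Type*} {A : Matrix ι ι ℝ} (hA : A.PosSemidef) (i j : ι) :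
    A i j ^ 2 ≤ A i i * A j j := by
  have h := (hA.submatrix ![i, j]).det_nonneg
  have hs : A j i = A i j := by simpa using hA.isHermitian.apply i j
  rw [det_fin_two] at h
  simp [hs] at h
  linarith

theorem PosSemidef.apply_eq_zero_of_diag {ι : Type*} {A : Matrix ι ι ℝ}
    (hA : A.PosSemidef) {i : ι} (h : A i i = 0) (j : ι) : A i j = 0 := by
  have := hA.sq_apply_le i j
  rw [h, zero_mul] at this
  exact pow_eq_zero_iff two_ne_zero |>.1 (le_antisymm this (sq_nonneg _))

theorem isClosed_setOf_posSemidef {ι : Type*} [Fintype ι] :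
    IsClosed {A : Matrix ι ι ℝ | A.PosSemidef} := by
  simp only [posSemidef_iff_dotProduct_mulVec, Set.ofPred_and, Set.ofPred_forall]
  refine IsClosed.inter (isClosed_eq (by fun_prop) (by fun_prop)) ?_
  exact isClosed_iInter fun x => isClosed_le (by fun_prop) (by fun_prop)

/-- A linear functional on `Matrix ι ι ℝ × ℝ` acts on symmetric matrices as the trace pairing with
the symmetrization of its matrix of coefficients. -/
theorem linearMap_prod_apply_of_isSymm {ι : Type*} [Fintype ι] [DecidableEq ι]
    (f : Matrix ι ι ℝ × ℝ →ₗ[ℝ] ℝ) {M : Matrix ι ι ℝ} (hM : M.IsSymm) (r : ℝ) :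
    f (M, r) = ((of fun k l => (f (single k l 1, 0) + f (single l k 1, 0)) / 2)ᵀ * M).trace
      + f (0, 1) * r := by
  have h1 : f (M, 0) = ∑ k, ∑ l, M k l * f (single k l 1, 0) := by
    have : f (M, 0) = (f ∘ₗ LinearMap.inl ℝ _ _) M := rfl
    rw [this]
    conv_lhs => rw [matrix_eq_sum_single M]
    simp only [map_sum]
    refine Finset.sum_congr rfl fun k _ => Finset.sum_congr rfl fun l _ => ?_
    have : single k l (M k l) = M k l • single k l (1 : ℝ) := by simp
    rw [this, map_smul]
    rfl
  have h2 : f (M, 0) = ∑ k, ∑ l, M k l * f (single l k 1, 0) := by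
    rw [h1, Finset.sum_comm]
    simp only [fun k l => hM.apply k l]
  have h3 : f (M, r) = f (M, 0) + f (0, 1) * r := by
    have : ((M, r) : Matrix ι ι ℝ × ℝ) = (M, 0) + r • (0, 1) := by simp
    rw [this, map_add, map_smul, smul_eq_mul, mul_comm]
  have h4 : f (M, 0) = ∑ k, ∑ l,
      (f (single k l 1, 0) + f (single l k 1, 0)) / 2 * M k l := by
    have h5 : f (M, 0) = (f (M, 0) + f (M, 0)) / 2 := by ring
    nth_rewrite 1 [h5]
    nth_rewrite 1 [h1]
    rw [h2]
    simp only [← Finset.sum_add_distrib, Finset.sum_div]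
    refine Finset.sum_congr rfl fun k _ => Finset.sum_congr rfl fun l _ => ?_
    ring
  rw [h3, h4, trace_transpose_mul_eq_sum]
  rfl

end Matrix

/-! ### Separation from a convex cone -/

/-- A point outside a convex cone that spans a finite-dimensional space can be weakly separated
from the cone by a nonzero functional; the cone need not be closed. -/
theorem PointedCone.exists_dual_ne_zero_of_notMem {V : Type*} [NormedAddCommGroup V]
    [NormedSpace ℝ V] [FiniteDimensional ℝ V] (K : PointedCone ℝ V)
    (hK : Submodule.span ℝ (K : Set V) = ⊤) {p : V} (hp : p ∉ K) :
    ∃ f : V →ₗ[ℝ] ℝ, f ≠ 0 ∧ (∀ z ∈ K, 0 ≤ f z) ∧ f p ≤ 0 := by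
  have hconv : Convex ℝ (K : Set V) := K.convex
  have hint : (interior (K : Set V)).Nonempty := by
    rw [hconv.interior_nonempty_iff_affineSpan_eq_top,
      ← Set.insert_eq_of_mem (show (0 : V) ∈ (K : Set V) from K.zero_mem), ← SetLike.coe_set_eq,
      affineSpan_insert_zero, hK]
    rfl
  obtain ⟨f, hf, hle⟩ := geometric_hahn_banach_of_nonempty_interior_point hconv
    (fun h => hp (interior_subset h)) hint
  have hfp : 0 ≤ f p := by simpa using hle 0 K.zero_mem
  refine ⟨-f.toLinearMap, fun h => hf ?_, fun z hz => ?_, by simpa using hfp⟩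
  · ext z
    simpa using congrArg (fun g : V →ₗ[ℝ] ℝ => g z) h
  · by_contra! hlt
    have hpos : 0 < f z := by simpa using hlt
    -- Scaling `z` up inside the cone would make `f` exceed `f p`.
    have hmem : ((f p + 1) / f z) • z ∈ K := K.smul_mem (by positivity) hz
    have := hle _ hmem
    rw [map_smul, smul_eq_mul, div_mul_cancel₀ _ hpos.ne'] at this
    linarith

namespace ParamMBQP

open Matrix

variable {n m : ℕ}

/-! ### Constraint matrices and the Lagrangian identity -/

theorem bordered_isSymm {t : ℝ} {v : Fin n → ℝ} {S : Matrix (Fin n) (Fin n) ℝ} (hS : S.IsSymm) :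
    (bordered t v S).IsSymm :=
  IsSymm.fromBlocks rfl rfl hS

theorem isSymm_of_bordered {t : ℝ} {v : Fin n → ℝ} {S : Matrix (Fin n) (Fin n) ℝ}
    (h : (bordered t v S).IsSymm) : S.IsSymm :=
  (isSymm_fromBlocks_iff.1 h).2.2.2

theorem smul_bordered (s t : ℝ) (v : Fin n → ℝ) (S : Matrix (Fin n) (Fin n) ℝ) :
    s • bordered t v S = bordered (s * t) (s • v) (s • S) := by
  ext (i | i) (j | j) <;> simp [bordered]

theorem trace_bordered_mul_bordered (s t : ℝ) (x v : Fin n → ℝ)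
    (X S : Matrix (Fin n) (Fin n) ℝ) :
    ((bordered s x X)ᵀ * bordered t v S).trace = s * t + 2 * (v ⬝ᵥ x) + (Xᵀ * S).trace := by
  simp only [trace_transpose_mul_eq_sum, Fintype.sum_sum_type]
  simp [bordered, dotProduct, Finset.sum_add_distrib, mul_comm]
  ring

/-- The combination of the constraint matrices weighted by the multipliers in `D`. -/
noncomputable def constraintMatrix (P : ParamMBQP n m) (D : DualVars n m) :
    Matrix (Unit ⊕ Fin n) (Unit ⊕ Fin n) ℝ :=
  ∑ j, D.γ j • bordered 0 ((1 / 2 : ℝ) • P.a j) 0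
    + ∑ j, D.ω j • bordered 0 0 (Matrix.vecMulVec (P.a j) (P.a j))
    + ∑ i ∈ P.B, D.κ i • bordered 0 ((1 / 2 : ℝ) • Pi.single i 1) (-Matrix.single i i 1)
    + ∑ i ∈ P.Bᶜ, D.φ i • bordered 0 0 (Matrix.single i i 1)
    + D.μ • bordered 1 0 0

/-- The symmetric matrix of the objective function. -/
noncomputable def costMatrix (P : ParamMBQP n m) : Matrix (Unit ⊕ Fin n) (Unit ⊕ Fin n) ℝ :=
  bordered 0 ((1 / 2 : ℝ) • P.c) P.Q

theorem dualMatrix_eq (P : ParamMBQP n m) (D : DualVars n m) :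
    P.dualMatrix D = P.costMatrix - P.constraintMatrix D := by
  simp only [dualMatrix, costMatrix, constraintMatrix]
  abel

theorem constraintMatrix_isSymm (P : ParamMBQP n m) (D : DualVars n m) :
    (P.constraintMatrix D).IsSymm := by
  have hb (t : ℝ) (v : Fin n → ℝ) (S : Matrix (Fin n) (Fin n) ℝ) :
      (bordered t v S)ᵀ = bordered t v Sᵀ := by simp [bordered, fromBlocks_transpose]; rfl
  simp [IsSymm, constraintMatrix, transpose_sum, hb]

theorem trace_bordered_mul_costMatrix (P : ParamMBQP n m) (t : ℝ) (x : Fin n → ℝ)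
    (X : Matrix (Fin n) (Fin n) ℝ) :
    ((bordered t x X)ᵀ * P.costMatrix).trace = P.sdpObjective x X := by
  rw [costMatrix, trace_bordered_mul_bordered, sdpObjective, ← trace_transpose (P.Qᵀ * X)]
  simp
  ring

/-- The Lagrangian identity: the pairing of the weighted constraint matrices with the matrix
`bordered t x X`, minus the scaled dual objective, is the weighted sum of the residuals of the
homogenized constraints. -/
theorem trace_bordered_mul_constraintMatrix (P : ParamMBQP n m) (U : Fin n → ℝ) (θ t : ℝ)
    (x : Fin n → ℝ) {X : Matrix (Fin n) (Fin n) ℝ} (hX : X.IsSymm) (D : DualVars n m) :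
    ((bordered t x X)ᵀ * P.constraintMatrix D).trace - t * P.dualObjective U θ D =
      ∑ j, D.γ j * (P.a j ⬝ᵥ x - t * P.b j θ)
      + ∑ j, D.ω j * ((vecMulVec (P.a j) (P.a j) * X).trace - t * P.b j θ ^ 2)
      + ∑ i ∈ P.B, D.κ i * (x i - X i i)
      + ∑ i ∈ P.Bᶜ, D.φ i * (X i i - t * U i ^ 2) := by
  simp only [constraintMatrix, dualObjective, mul_add, trace_add, Finset.mul_sum, trace_sum,
    Matrix.mul_smul, trace_smul, trace_bordered_mul_bordered, mul_sub, Finset.sum_sub_distrib]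
  have hcomm (a b : ℝ) : t * (a * b) = b * (t * a) := by ring
  simp [hX.eq, trace_mul_comm X, trace_single_mul, mul_add, Finset.sum_add_distrib, hcomm]
  ring

/-! ### Homogenized feasibility and weak duality -/

/-- Feasibility for the conic constraints of the relaxation after homogenization: the corner entry
of `Y` is `t` instead of `1`, and the right-hand sides are scaled by `t`. -/
structure HomogeneousFeasible (P : ParamMBQP n m) (U : Fin n → ℝ) (θ t : ℝ)
    (x : Fin n → ℝ) (X : Matrix (Fin n) (Fin n) ℝ) : Prop where
  linear : ∀ j, P.a j ⬝ᵥ x = t * P.b j θ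
  squared : ∀ j, (vecMulVec (P.a j) (P.a j) * X).trace = t * P.b j θ ^ 2
  diag_le : ∀ i ∉ P.B, X i i ≤ t * U i ^ 2
  binary : ∀ i ∈ P.B, x i = X i i
  psd : (bordered t x X).PosSemidef
  nonneg : ∀ k l, 0 ≤ bordered t x X k l

theorem HomogeneousFeasible.sdpFeasible {P : ParamMBQP n m} {U : Fin n → ℝ} {θ t : ℝ}
    {x : Fin n → ℝ} {X : Matrix (Fin n) (Fin n) ℝ} (h : P.HomogeneousFeasible U θ t x X)
    (ht : 0 < t) : P.SDPFeasible U θ (t⁻¹ • x) (t⁻¹ • X) := by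
  have hb : bordered 1 (t⁻¹ • x) (t⁻¹ • X) = t⁻¹ • bordered t x X := by
    rw [smul_bordered, inv_mul_cancel₀ ht.ne']
  refine ⟨fun j => ?_, fun j => ?_, fun i hi => ?_, fun i hi => ?_, ?_, fun k l => ?_⟩
  · rw [dotProduct_smul, h.linear, smul_eq_mul, inv_mul_cancel_left₀ ht.ne']
  · rw [Matrix.mul_smul, trace_smul, h.squared, smul_eq_mul, inv_mul_cancel_left₀ ht.ne']
  · rw [Matrix.smul_apply, smul_eq_mul, inv_mul_le_iff₀ ht]
    exact h.diag_le i hi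
  · simp [h.binary i hi]
  · rw [hb]
    exact h.psd.smul (inv_nonneg.2 ht.le)
  · rw [hb]
    exact mul_nonneg (inv_nonneg.2 ht.le) (h.nonneg k l)

/-- The relaxation has no nonzero recession direction: a vanishing corner kills the border, hence
the diagonal at the binary coordinates, and the bounds kill the rest of the diagonal. -/
theorem HomogeneousFeasible.bordered_eq_zero {P : ParamMBQP n m} {U : Fin n → ℝ} {θ : ℝ}
    {x : Fin n → ℝ} {X : Matrix (Fin n) (Fin n) ℝ} (h : P.HomogeneousFeasible U θ 0 x X) :
    bordered 0 x X = 0 := by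
  have hx (i : Fin n) : x i = 0 := by
    simpa [bordered] using h.psd.apply_eq_zero_of_diag (i := .inl ()) rfl (.inr i)
  have hX (i : Fin n) : X i i = 0 := by
    by_cases hi : i ∈ P.B
    · rw [← h.binary i hi, hx]
    · exact le_antisymm (by simpa using h.diag_le i hi) (h.nonneg (.inr i) (.inr i))
  ext (i | i) l
  · exact h.psd.apply_eq_zero_of_diag (i := .inl i) rfl l
  · exact h.psd.apply_eq_zero_of_diag (i := .inr i) (hX i) l

theorem SDPFeasible.dualObjective_le {P : ParamMBQP n m} {U : Fin n → ℝ} {θ : ℝ} {x : Fin n → ℝ}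
    {X : Matrix (Fin n) (Fin n) ℝ} (h : P.SDPFeasible U θ x X) {D : DualVars n m}
    (hD : P.DualFeasible D) : P.dualObjective U θ D ≤ P.sdpObjective x X := by
  have hX : X.IsSymm := isSymm_of_bordered h.psd.isHermitian.isSymm
  have hL := P.trace_bordered_mul_constraintMatrix U θ 1 x hX D
  have hΘ := trace_transpose_mul_nonneg_of_entrywise h.nonneg hD.theta_nonneg
  have hΩ := h.psd.trace_transpose_mul_nonneg hD.omega_psd
  have hC := P.trace_bordered_mul_costMatrix 1 x X
  have hst : P.costMatrix = P.constraintMatrix D + (D.Θ + D.Ω) := by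
    rw [← hD.stationarity, dualMatrix_eq]
    abel
  rw [hst, mul_add, mul_add, trace_add, trace_add] at hC
  have hφ : 0 ≤ ∑ i ∈ P.Bᶜ, D.φ i * (X i i - 1 * U i ^ 2) :=
    Finset.sum_nonneg fun i hi => by
      have hi := Finset.mem_compl.1 hi
      exact mul_nonneg_of_nonpos_of_nonpos (hD.phi_nonpos i hi) (by linarith [h.diag_le i hi])
  have hγ : ∑ j, D.γ j * (P.a j ⬝ᵥ x - 1 * P.b j θ) = 0 :=
    Finset.sum_eq_zero fun j _ => by rw [h.linear]; ring
  have hω : ∑ j, D.ω j * ((vecMulVec (P.a j) (P.a j) * X).trace - 1 * P.b j θ ^ 2) = 0 :=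
    Finset.sum_eq_zero fun j _ => by rw [h.squared]; ring
  have hκ : ∑ i ∈ P.B, D.κ i * (x i - X i i) = 0 :=
    Finset.sum_eq_zero fun i hi => by rw [h.binary i hi]; ring
  linarith

/-! ### The dual cone and strong duality -/

/-- The cone of all pairs `(M, r)` such that a program with cost matrix `M` would have a dual
feasible point of objective value `r`. -/
noncomputable def dualCone (P : ParamMBQP n m) (U : Fin n → ℝ) (θ : ℝ) :
    PointedCone ℝ (Matrix (Unit ⊕ Fin n) (Unit ⊕ Fin n) ℝ × ℝ) where
  carrier := {z | ∃ D : DualVars n m, (∀ i ∉ P.B, D.φ i ≤ 0) ∧ (∀ k l, 0 ≤ D.Θ k l) ∧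
    D.Ω.PosSemidef ∧ z = (P.constraintMatrix D + D.Θ + D.Ω, P.dualObjective U θ D)}
  zero_mem' := ⟨⟨0, 0, 0, 0, 0, 0, 0⟩, by simp, by simp, .zero, by
    simp [constraintMatrix, dualObjective]; rfl⟩
  add_mem' := by
    rintro _ _ ⟨D, h1, h2, h3, rfl⟩ ⟨E, h4, h5, h6, rfl⟩
    refine ⟨⟨D.γ + E.γ, D.ω + E.ω, D.κ + E.κ, D.φ + E.φ, D.μ + E.μ, D.Θ + E.Θ, D.Ω + E.Ω⟩,
      fun i hi => add_nonpos (h1 i hi) (h4 i hi), fun k l => add_nonneg (h2 k l) (h5 k l),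
      h3.add h6, Prod.ext ?_ ?_⟩
    · simp only [constraintMatrix, Pi.add_apply, add_smul, Finset.sum_add_distrib, Prod.mk_add_mk]
      abel
    · simp only [dualObjective, Pi.add_apply, mul_add, Finset.sum_add_distrib, Prod.mk_add_mk]
      ring
  smul_mem' := by
    rintro ⟨s, hs⟩ _ ⟨D, h1, h2, h3, rfl⟩
    refine ⟨⟨s • D.γ, s • D.ω, s • D.κ, s • D.φ, s * D.μ, s • D.Θ, s • D.Ω⟩,
      fun i hi => mul_nonpos_of_nonneg_of_nonpos hs (h1 i hi),
      fun k l => mul_nonneg hs (h2 k l), h3.smul hs, Prod.ext ?_ ?_⟩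
    · change s • (P.constraintMatrix D + D.Θ + D.Ω) = _
      simp only [constraintMatrix, Pi.smul_apply, smul_add, Finset.smul_sum, smul_smul, smul_eq_mul]
    · change s * P.dualObjective U θ D = _
      simp only [dualObjective, Pi.smul_apply, mul_add, Finset.mul_sum, smul_eq_mul,
        mul_left_comm s]

theorem mem_dualCone_of_nonneg (P : ParamMBQP n m) (U : Fin n → ℝ) (θ : ℝ)
    {Θ : Matrix (Unit ⊕ Fin n) (Unit ⊕ Fin n) ℝ} (hΘ : ∀ k l, 0 ≤ Θ k l) :
    (Θ, 0) ∈ P.dualCone U θ :=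
  ⟨⟨0, 0, 0, 0, 0, Θ, 0⟩, by simp, hΘ, .zero, by simp [constraintMatrix, dualObjective]⟩

theorem mem_dualCone_of_posSemidef (P : ParamMBQP n m) (U : Fin n → ℝ) (θ : ℝ)
    {Ω : Matrix (Unit ⊕ Fin n) (Unit ⊕ Fin n) ℝ} (hΩ : Ω.PosSemidef) :
    (Ω, 0) ∈ P.dualCone U θ :=
  ⟨⟨0, 0, 0, 0, 0, 0, Ω⟩, by simp, by simp, hΩ, by simp [constraintMatrix, dualObjective]⟩

theorem constraintMatrix_mem_dualCone (P : ParamMBQP n m) (U : Fin n → ℝ) (θ : ℝ)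
    {D : DualVars n m} (hD : ∀ i ∉ P.B, D.φ i ≤ 0) :
    (P.constraintMatrix D, P.dualObjective U θ D) ∈ P.dualCone U θ :=
  ⟨⟨D.γ, D.ω, D.κ, D.φ, D.μ, 0, 0⟩, hD, by simp, .zero, by
    simp [constraintMatrix, dualObjective]⟩

theorem smul_corner_mem_dualCone (P : ParamMBQP n m) (U : Fin n → ℝ) (θ s : ℝ) :
    (s • single (.inl ()) (.inl ()) 1, s) ∈ P.dualCone U θ := by
  convert P.constraintMatrix_mem_dualCone U θ (D := ⟨0, 0, 0, 0, s, 0, 0⟩) (by simp) using 2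
  · ext (i | i) (j | j) <;> simp [constraintMatrix, bordered]
  · simp [dualObjective]

theorem single_mem_dualCone (P : ParamMBQP n m) (U : Fin n → ℝ) (θ : ℝ) (k l : Unit ⊕ Fin n) :
    (single k l 1, 0) ∈ P.dualCone U θ :=
  P.mem_dualCone_of_nonneg U θ fun i j => by
    rw [single_apply]
    split_ifs <;> simp

theorem span_dualCone (P : ParamMBQP n m) (U : Fin n → ℝ) (θ : ℝ) :
    Submodule.span ℝ (P.dualCone U θ : Set (Matrix (Unit ⊕ Fin n) (Unit ⊕ Fin n) ℝ × ℝ)) = ⊤ := by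
  refine eq_top_iff.2 fun ⟨M, r⟩ _ => ?_
  set S := Submodule.span ℝ (P.dualCone U θ : Set (Matrix (Unit ⊕ Fin n) (Unit ⊕ Fin n) ℝ × ℝ))
  have hM (M : Matrix (Unit ⊕ Fin n) (Unit ⊕ Fin n) ℝ) : (M, (0 : ℝ)) ∈ S := by
    change LinearMap.inl ℝ _ ℝ M ∈ S
    rw [matrix_eq_sum_single M]
    simp only [map_sum]
    refine S.sum_mem fun k _ => S.sum_mem fun l _ => ?_
    have : single k l (M k l) = M k l • single k l (1 : ℝ) := by simp
    rw [this, map_smul]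
    exact S.smul_mem _ (Submodule.subset_span (P.single_mem_dualCone U θ k l))
  have hr := Submodule.subset_span (R := ℝ) (P.smul_corner_mem_dualCone U θ r)
  have h := S.add_mem hr (hM (M - r • single (.inl ()) (.inl ()) 1))
  rwa [Prod.mk_add_mk, add_sub_cancel, add_zero] at h

/-- A functional that is nonnegative on the dual cone is a homogenized primal point: the
symmetrization of its matrix of coefficients satisfies the constraints of the relaxation, scaled
by minus its coefficient on the objective coordinate. -/
theorem exists_homogeneousFeasible_of_nonneg_on_dualCone (P : ParamMBQP n m) (U : Fin n → ℝ)
    (θ : ℝ) (f : Matrix (Unit ⊕ Fin n) (Unit ⊕ Fin n) ℝ × ℝ →ₗ[ℝ] ℝ)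
    (hf : ∀ z ∈ P.dualCone U θ, 0 ≤ f z) :
    ∃ x X, P.HomogeneousFeasible U θ (-f (0, 1)) x X ∧
      bordered (-f (0, 1)) x X =
        of fun k l => (f (single k l 1, 0) + f (single l k 1, 0)) / 2 := by
  set Y : Matrix (Unit ⊕ Fin n) (Unit ⊕ Fin n) ℝ :=
    of fun k l => (f (single k l 1, 0) + f (single l k 1, 0)) / 2 with hY
  have hYs : Y.IsSymm := by
    ext k l
    simp [hY, add_comm]
  set t := -f (0, 1) with ht
  have hcorner : f (single (.inl ()) (.inl ()) 1, 0) = t := by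
    have h1 := hf _ (P.smul_corner_mem_dualCone U θ 1)
    have h2 := hf _ (P.smul_corner_mem_dualCone U θ (-1))
    have e (s : ℝ) : f (s • single (.inl ()) (.inl ()) 1, s) =
        s * (f (single (.inl ()) (.inl ()) 1, 0) - t) := by
      rw [ht, sub_neg_eq_add, ← map_add, ← smul_eq_mul, ← map_smul]
      simp
    rw [e] at h1 h2
    linarith
  have hb : bordered t (fun i => Y (.inl ()) (.inr i)) Y.toBlocks₂₂ = Y := by
    ext (i | i) (j | j)
    · simp [bordered, hY, hcorner]
    · rfl
    · exact hYs.apply _ _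
    · rfl
  have hXs : Y.toBlocks₂₂.IsSymm := by
    ext i j
    exact hYs.apply _ _
  have happly {M : Matrix (Unit ⊕ Fin n) (Unit ⊕ Fin n) ℝ} (hM : M.IsSymm) (r : ℝ) :
      f (M, r) = (Yᵀ * M).trace - t * r := by
    rw [linearMap_prod_apply_of_isSymm f hM r, ht]
    ring
  have hLag (D : DualVars n m) (hD : ∀ i ∉ P.B, D.φ i ≤ 0) := by
    have h := hf _ (P.constraintMatrix_mem_dualCone U θ hD)
    rw [happly (P.constraintMatrix_isSymm D), ← hb,
      P.trace_bordered_mul_constraintMatrix U θ t _ hXs D] at h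
    exact h
  refine ⟨_, _, ⟨fun j => ?_, fun j => ?_, fun i hi => ?_, fun i hi => ?_, ?_, fun k l => ?_⟩, hb⟩
  · have h1 := hLag ⟨Pi.single j 1, 0, 0, 0, 0, 0, 0⟩ (by simp)
    have h2 := hLag ⟨Pi.single j (-1), 0, 0, 0, 0, 0, 0⟩ (by simp)
    simp [Pi.single_apply] at h1 h2
    linarith
  · have h1 := hLag ⟨0, Pi.single j 1, 0, 0, 0, 0, 0⟩ (by simp)
    have h2 := hLag ⟨0, Pi.single j (-1), 0, 0, 0, 0, 0⟩ (by simp)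
    simp [Pi.single_apply] at h1 h2
    linarith
  · have h1 := hLag ⟨0, 0, 0, Pi.single i (-1), 0, 0, 0⟩ fun k _ => by
      simp only [Pi.single_apply]
      split_ifs <;> simp
    simp [Pi.single_apply, hi] at h1
    linarith
  · have h1 := hLag ⟨0, 0, Pi.single i 1, 0, 0, 0, 0⟩ (by simp)
    have h2 := hLag ⟨0, 0, Pi.single i (-1), 0, 0, 0, 0⟩ (by simp)
    simp [Pi.single_apply, hi] at h1 h2
    linarith
  · rw [hb]
    have hYh : Y.IsHermitian := by
      rw [IsHermitian, conjTranspose_eq_transpose_of_trivial]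
      exact hYs
    refine .of_dotProduct_mulVec_nonneg hYh fun v => ?_
    have hv : (vecMulVec v v).PosSemidef := by simpa using posSemidef_vecMulVec_self_star v
    have h := hf _ (P.mem_dualCone_of_posSemidef U θ hv)
    rw [happly hv.isHermitian.isSymm, trace_transpose_mul_eq_sum] at h
    simp only [star_trivial, dotProduct, mulVec, Finset.mul_sum]
    rw [mul_zero, sub_zero] at h
    refine h.trans_eq (Finset.sum_congr rfl fun k _ => Finset.sum_congr rfl fun l _ => ?_)
    rw [vecMulVec_apply]
    ring
  · rw [hb]
    have h1 := hf _ (P.single_mem_dualCone U θ k l)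
    have h2 := hf _ (P.single_mem_dualCone U θ l k)
    simp only [hY, of_apply]
    linarith

/-- Every number below all objective values of the relaxation is the objective value of a dual
feasible point. -/
theorem mem_dualValues_of_lt (P : ParamMBQP n m) (hQ : P.Q.IsSymm) (U : Fin n → ℝ) (θ : ℝ)
    {w : ℝ} (hw : ∀ x X, P.SDPFeasible U θ x X → w < P.sdpObjective x X) :
    w ∈ P.dualValues U θ := by
  by_cases hmem : (P.costMatrix, w) ∈ P.dualCone U θ
  · obtain ⟨D, h1, h2, h3, h4⟩ := hmem
    obtain ⟨hC, hr⟩ := Prod.ext_iff.1 h4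
    refine ⟨D, ⟨?_, h1, h2, h3⟩, hr⟩
    rw [dualMatrix_eq, show P.costMatrix = _ from hC, add_assoc, add_sub_cancel_left]
  exfalso
  let _ : NormedAddCommGroup (Matrix (Unit ⊕ Fin n) (Unit ⊕ Fin n) ℝ) := Matrix.normedAddCommGroup
  let _ : NormedSpace ℝ (Matrix (Unit ⊕ Fin n) (Unit ⊕ Fin n) ℝ) := Matrix.normedSpace
  obtain ⟨f, hf0, hf, hfp⟩ :=
    (P.dualCone U θ).exists_dual_ne_zero_of_notMem (P.span_dualCone U θ) hmem
  obtain ⟨x, X, hxX, hY⟩ := P.exists_homogeneousFeasible_of_nonneg_on_dualCone U θ f hf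
  have hCs : P.costMatrix.IsSymm := bordered_isSymm hQ
  rw [linearMap_prod_apply_of_isSymm f hCs, ← hY, trace_bordered_mul_costMatrix] at hfp
  have ht : 0 ≤ -f (0, 1) := hxX.nonneg (.inl ()) (.inl ())
  rcases ht.lt_or_eq with ht | ht
  -- For a positive corner, rescaling gives a feasible point of objective value at most `w`.
  · have h := hw _ _ (hxX.sdpFeasible ht)
    have e : P.sdpObjective ((-f (0, 1))⁻¹ • x) ((-f (0, 1))⁻¹ • X) =
        (-f (0, 1))⁻¹ * P.sdpObjective x X := by
      simp only [sdpObjective, Matrix.mul_smul, trace_smul, dotProduct_smul, smul_eq_mul, mul_add]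
    rw [e, lt_inv_mul_iff₀ ht] at h
    linarith
  · rw [← ht] at hxX hY
    rw [hxX.bordered_eq_zero] at hY
    -- The symmetrized coefficients vanish, and nonnegativity makes the coefficients vanish.
    have hs (k l : Unit ⊕ Fin n) : f (single k l 1, 0) = 0 := by
      have h0 := congrFun (congrFun hY k) l
      have h1 := hf _ (P.single_mem_dualCone U θ k l)
      have h2 := hf _ (P.single_mem_dualCone U θ l k)
      simp only [of_apply, Matrix.zero_apply] at h0
      linarith
    have h1 : f (0, 1) = 0 := by linarith
    refine hf0 (LinearMap.prod_ext ?_ (LinearMap.ext_ring (by simpa using h1)))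
    refine Matrix.ext_linearMap (R := ℝ) fun k l => LinearMap.ext_ring ?_
    simpa using hs k l

/-! ### Compactness and nonemptiness of the feasible set -/

/-- The diagonal of a feasible `X` is bounded by the constraints, at the binary coordinates because
`x i ^ 2 ≤ X i i = x i`; positive semidefiniteness then bounds all entries. -/
theorem SDPFeasible.apply_le {P : ParamMBQP n m} {U : Fin n → ℝ} {θ : ℝ} {x : Fin n → ℝ}
    {X : Matrix (Fin n) (Fin n) ℝ} (h : P.SDPFeasible U θ x X) :
    (∀ i, x i ≤ 1 + ∑ i, U i ^ 2) ∧ ∀ i j, X i j ≤ 1 + ∑ i, U i ^ 2 := by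
  set R := 1 + ∑ i, U i ^ 2 with hR
  have hR1 : 1 ≤ R := le_add_of_nonneg_right (Finset.sum_nonneg fun i _ => sq_nonneg _)
  have hx (i : Fin n) : x i ^ 2 ≤ X i i := by
    simpa [bordered] using h.psd.sq_apply_le (.inl ()) (.inr i)
  have hd (i : Fin n) : X i i ≤ R := by
    by_cases hi : i ∈ P.B
    · have := hx i
      rw [h.binary i hi] at this
      nlinarith
    · have := Finset.single_le_sum (f := fun i => U i ^ 2) (fun i _ => sq_nonneg _)
        (Finset.mem_univ i)
      have := h.diag_le i hi
      linarith
  refine ⟨fun i => ?_, fun i j => ?_⟩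
  · nlinarith [hx i, hd i]
  · have h1 : X i j ^ 2 ≤ X i i * X j j := h.psd.sq_apply_le (.inr i) (.inr j)
    have h2 : X i i * X j j ≤ R * R :=
      mul_le_mul (hd i) (hd j) (h.nonneg (.inr j) (.inr j)) (by linarith)
    exact le_of_sq_le_sq (by linarith [sq R]) (by linarith)

theorem isCompact_sdpFeasible (P : ParamMBQP n m) (U : Fin n → ℝ) (θ : ℝ) :
    IsCompact {q : (Fin n → ℝ) × Matrix (Fin n) (Fin n) ℝ | P.SDPFeasible U θ q.1 q.2} := by
  have hcont : Continuous fun q : (Fin n → ℝ) × Matrix (Fin n) (Fin n) ℝ =>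
      bordered 1 q.1 q.2 := by
    refine continuous_matrix fun k l => ?_
    rcases k with k | k <;> rcases l with l | l <;> simp only [bordered, fromBlocks_apply₁₁,
      fromBlocks_apply₁₂, fromBlocks_apply₂₁, fromBlocks_apply₂₂, of_apply, replicateRow_apply,
      replicateCol_apply] <;> fun_prop
  have hclosed : IsClosed
      {q : (Fin n → ℝ) × Matrix (Fin n) (Fin n) ℝ | P.SDPFeasible U θ q.1 q.2} := by
    have e : {q : (Fin n → ℝ) × Matrix (Fin n) (Fin n) ℝ | P.SDPFeasible U θ q.1 q.2} =
        {q | (∀ j, P.a j ⬝ᵥ q.1 = P.b j θ) ∧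
          (∀ j, (vecMulVec (P.a j) (P.a j) * q.2).trace = P.b j θ ^ 2) ∧
          (∀ i, i ∉ P.B → q.2 i i ≤ U i ^ 2) ∧ (∀ i, i ∈ P.B → q.1 i = q.2 i i) ∧
          (bordered 1 q.1 q.2).PosSemidef ∧ ∀ k l, 0 ≤ bordered 1 q.1 q.2 k l} :=
      Set.ext fun q => ⟨fun h => ⟨h.1, h.2, h.3, h.4, h.5, h.6⟩,
        fun h => ⟨h.1, h.2.1, h.2.2.1, h.2.2.2.1, h.2.2.2.2.1, h.2.2.2.2.2⟩⟩
    rw [e]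
    simp only [Set.ofPred_and, Set.ofPred_forall]
    refine .inter (isClosed_iInter fun j => isClosed_eq (by fun_prop) (by fun_prop)) <|
      .inter (isClosed_iInter fun j => isClosed_eq (by fun_prop) (by fun_prop)) <|
      .inter (isClosed_iInter fun i => isClosed_iInter fun _ =>
        isClosed_le (by fun_prop) (by fun_prop)) <|
      .inter (isClosed_iInter fun i => isClosed_iInter fun _ =>
        isClosed_eq (by fun_prop) (by fun_prop)) <|
      .inter (isClosed_setOf_posSemidef.preimage hcont) <|
      isClosed_iInter fun k => isClosed_iInter fun l =>
        isClosed_le (by fun_prop) (hcont.matrix_elem k l)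
  have hbox : IsCompact ((Set.univ.pi fun _ : Fin n => Set.Icc 0 (1 + ∑ i, U i ^ 2)) ×ˢ
      (Set.univ.pi fun _ : Fin n => Set.univ.pi fun _ : Fin n => Set.Icc 0 (1 + ∑ i, U i ^ 2) :
        Set (Matrix (Fin n) (Fin n) ℝ))) :=
    (isCompact_univ_pi fun _ => isCompact_Icc).prod
      (isCompact_univ_pi fun _ => isCompact_univ_pi fun _ => isCompact_Icc)
  refine hbox.of_isClosed_subset hclosed fun q hq => ?_
  obtain ⟨hx, hX⟩ := SDPFeasible.apply_le hq
  exact ⟨fun i _ => ⟨hq.nonneg (.inl ()) (.inr i), hx i⟩,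
    fun i _ j _ => ⟨hq.nonneg (.inr i) (.inr j), hX i j⟩⟩

/-- A feasible point of the program lifts to the rank-one point of the relaxation. -/
theorem IsFeasible.sdpFeasible {P : ParamMBQP n m} {U : Fin n → ℝ} {θ : ℝ} {x : Fin n → ℝ}
    (h : P.IsFeasible θ x) (hU : P.ContinuousVarsBoundedBy θ U) :
    P.SDPFeasible U θ x (vecMulVec x x) := by
  have hb : bordered 1 x (vecMulVec x x) =
      vecMulVec (Sum.elim (fun _ => 1) x) (Sum.elim (fun _ => 1) x) := by
    ext (i | i) (j | j) <;> simp [bordered, vecMulVec_apply]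
  refine ⟨h.1, fun j => ?_, fun i hi => ?_, fun i hi => ?_, ?_, fun k l => ?_⟩
  · rw [vecMulVec_mul_vecMulVec, trace_vecMulVec, ← h.1 j]
    simp [dotProduct_smul, sq]
  · rw [vecMulVec_apply, ← sq]
    exact pow_le_pow_left₀ (h.2.1 i) (hU x h i hi) 2
  · rcases h.2.2 i hi with h0 | h0 <;> simp [vecMulVec_apply, h0]
  · rw [hb]
    simpa using posSemidef_vecMulVec_self_star (Sum.elim (fun _ : Unit => (1 : ℝ)) x)
  · rw [hb, vecMulVec_apply]
    have hx (k : Unit ⊕ Fin n) : 0 ≤ Sum.elim (fun _ => 1) x k := by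
      rcases k with k | k
      · exact zero_le_one
      · exact h.2.1 k
    exact mul_nonneg (hx k) (hx l)

end ParamMBQP

theorem proposition1 {n m : ℕ} (P : ParamMBQP n m) (hQ : P.Q.PosSemidef)
    (U : Fin n → ℝ) (θ : ℝ)
    (hfeas : ∃ x, P.IsFeasible θ x)
    (hbound : P.ContinuousVarsBoundedBy θ U) :
    P.StrongDuality U θ := by
  obtain ⟨x₀, hx₀⟩ := hfeas
  obtain ⟨⟨x, X⟩, hxX, hmin⟩ := (P.isCompact_sdpFeasible U θ).exists_isMinOn
    ⟨(x₀, _), hx₀.sdpFeasible hbound⟩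
    (f := fun q => P.sdpObjective q.1 q.2)
    (by unfold ParamMBQP.sdpObjective; fun_prop)
  have hle : ∀ x' X', P.SDPFeasible U θ x' X' → P.sdpObjective x X ≤ P.sdpObjective x' X' :=
    fun x' X' h => hmin (a := (x', X')) h
  refine ⟨P.sdpObjective x X, ⟨⟨x, X, hxX, rfl⟩, ?_⟩, ?_, fun u hu => ?_⟩
  · rintro _ ⟨x', X', h, rfl⟩
    exact hle x' X' h
  · rintro _ ⟨D, hD, rfl⟩
    exact hxX.dualObjective_le hD
  · refine le_of_forall_lt_imp_le_of_dense fun w hw => hu ?_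
    exact P.mem_dualValues_of_lt hQ.isHermitian.isSymm U θ
      fun x' X' h => hw.trans_le (hle x' X' h)
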